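/- Let $\Lambda=[0,\omega_1]$ be the standard closed long line: the set of all $\alpha+t$ with $\alpha<\omega_1$ an ordinal and $t\in[0,1)$, ordered lexicographically, together with a largest point $\omega_1$, with the order topology. For $n\ge 1$ let $\Sigma^{(n)}$ be the quotient space obtained from $n$ disjoint copies of $\Lambda$, indexed by $\mathbb Z/n$, by identifying, for each $i\in\mathbb Z/n$, the right endpoint of the $i$th copy with the left endpoint of the $(i+1)$st copy; in particular $\Sigma^{(1)}$ is $\Lambda$ with its two endpoints identified to one point $\infty$. For $m,n\ge1$ let $\phi^m_n:\Sigma^{(mn)}\to\Sigma^{(n)}$ send the point $x$ of the $i$th copy of $\Lambda$ to the point $x$ of the copy with index $i \bmod n$. For a sequence $\vec p=\langle p_1,p_2,\dots\rangle$ of positive integers put $k(1)=1$, $k(n)=p_1p_2\cdots p_{n-1}$ for $n>1$, and $$S(\Lambda,\vec p)=\varprojlim\{\phi^{p_n}_{k(n)},\ \Sigma^{(k(n))},\ n\ge 1\},$$ whose points are sequences $\vec s=(s_1,s_2,\dots)$ with $s_n\in\Sigma^{(k(n))}$ and $\phi^{p_n}_{k(n)}(s_{n+1})=s_n$. Theorem.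 For every sequence $\vec p$ of positive integers, $S(\Lambda,\vec p)$ is $\frac12$-homogeneous, i.e. the action of its group of autohomeomorphisms on it has exactly two orbits. These orbits are $$O_1=\{\vec s\in S(\Lambda,\vec p): s_1\neq\infty\}\quad\text{and}\quad O_2=\{\vec s\in S(\Lambda,\vec p): s_1=\infty\}.$$ Moreover, $S(\Lambda,\vec p)$ is first countable at every point of $O_1$, while for no point $\vec s\in O_2$ is $\{\vec s\}$ a $G_\delta$ subset of $S(\Lambda,\vec p)$. -/

import Mathlib

open scoped Topology Ordinal

/-- The closed long line `[0, ω₁]`: the pairs `(α, t)` with `α < ω₁` and `0 ≤ t < 1` in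
lexicographic order (so `(α, 0)` is the ordinal `α`, and a copy of the open interval `(0, 1)`
sits between `α` and `α + 1`), together with a largest point `ω₁`. -/
def ClosedLongLine : Type 1 :=
  WithTop (Set.Iio (ω₁ : Ordinal.{0}) ×ₗ Set.Ico (0 : ℝ) 1)

namespace ClosedLongLine

noncomputable instance : LinearOrder ClosedLongLine :=
  inferInstanceAs (LinearOrder (WithTop (Set.Iio (ω₁ : Ordinal.{0}) ×ₗ Set.Ico (0 : ℝ) 1)))

instance : OrderTop ClosedLongLine :=
  inferInstanceAs (OrderTop (WithTop (Set.Iio (ω₁ : Ordinal.{0}) ×ₗ Set.Ico (0 : ℝ) 1)))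

/-- The left endpoint `0` of the closed long line. -/
instance : OrderBot ClosedLongLine where
  bot := WithTop.some
    (toLex (⟨0, Ordinal.omega_pos 1⟩, ⟨0, le_refl 0, zero_lt_one⟩))
  bot_le x := by
    induction x using WithTop.recTopCoe with
    | top => exact le_top
    | coe x =>
      refine WithTop.coe_le_coe.2 ((Prod.Lex.le_iff).2 ?_)
      rcases (bot_le : (0 : Ordinal) ≤ (ofLex x).1.1).lt_or_eq with h | h
      · exact Or.inl h
      · exact Or.inr ⟨Subtype.ext h, (ofLex x).2.2.1⟩

/-- The order topology. -/
noncomputable instance : TopologicalSpace ClosedLongLine := Preorder.topology ClosedLongLine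

instance : OrderTopology ClosedLongLine := ⟨rfl⟩

end ClosedLongLine

section Solenoid

variable (L : Type*) [LinearOrder L] [OrderBot L] [OrderTop L] [TopologicalSpace L]

/-- The generating identifications on `n` copies of `L`, indexed by the residues mod `n`: the right
endpoint of the `i`-th copy is identified with the left endpoint of the `(i+1)`-st copy
(cyclically). -/
def GlueRel (n : ℕ) (a b : ZMod n × L) : Prop :=
  ∃ i : ZMod n, a = (i, ⊤) ∧ b = (i + 1, ⊥)

/-- `Σ⁽ⁿ⁾`: `n ≥ 1` copies of `L` laid end to end in a circle, with the quotient topology. -/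
def CopiesCircle (n : ℕ) : Type _ := Quot (GlueRel L n)

instance (n : ℕ) : TopologicalSpace (CopiesCircle L n) :=
  inferInstanceAs (TopologicalSpace (Quot (GlueRel L n)))

/-- The point of `Σ⁽ⁿ⁾` given by the point `x` of the `i`-th copy of `L`. -/
def CopiesCircle.mk {L : Type*} [LinearOrder L] [OrderBot L] [OrderTop L]
    {n : ℕ} (i : ZMod n) (x : L) : CopiesCircle L n :=
  Quot.mk (GlueRel L n) (i, x)

/-- The glued point `∞ᵢ` of `Σ⁽ⁿ⁾`, the left endpoint of the `i`-th copy of `L`. -/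
def CopiesCircle.infty {n : ℕ} (i : ZMod n) : CopiesCircle L n :=
  CopiesCircle.mk i ⊥

/-- The natural map `Σ⁽ᵐⁿ⁾ → Σ⁽ⁿ⁾` sending the point `x` of the `i`-th copy to the point `x` of the
copy with index `i mod n`. -/
def bondingMap (m n : ℕ) : CopiesCircle L (m * n) → CopiesCircle L n :=
  Quot.lift
    (fun a => CopiesCircle.mk (ZMod.castHom (Dvd.intro_left m rfl) (ZMod n) a.1) a.2)
    (by
      rintro _ _ ⟨i, rfl, rfl⟩
      refine Quot.sound ⟨ZMod.castHom (Dvd.intro_left m rfl) (ZMod n) i, rfl, ?_⟩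
      simp only [map_add, map_one])

/-- The number of copies in the `n`-th factor: the product of the first `n` terms of `p`. Sequences
and factors are indexed from `0`. -/
def numCopies (p : ℕ → ℕ) : ℕ → ℕ
  | 0 => 1
  | n + 1 => p n * numCopies p n

/-- `S(L, p)`: the inverse limit of the circles `Σ⁽ᵏ⁽ⁿ⁾⁾`, `k n = p 0 * ⋯ * p (n - 1)`, along the
natural maps, as a subspace of the product. -/
def LongSolenoid (p : ℕ → ℕ) : Type _ :=
  {s : (n : ℕ) → CopiesCircle L (numCopies p n) //
    ∀ n, bondingMap L (p n) (numCopies p n) (s (n + 1)) = s n}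

instance (p : ℕ → ℕ) : TopologicalSpace (LongSolenoid L p) :=
  instTopologicalSpaceSubtype

/-- The first coordinate, a point of the circle `Σ = Σ⁽¹⁾`. -/
def LongSolenoid.first {L : Type*} [LinearOrder L] [OrderBot L] [OrderTop L]
    {p : ℕ → ℕ} (s : LongSolenoid L p) : CopiesCircle L 1 :=
  s.1 0

end Solenoid

/-- The orbit of `x` under the group of autohomeomorphisms of `Y`. -/
def homeoOrbit {Y : Type*} [TopologicalSpace Y] (x : Y) : Set Y :=
  {y | ∃ h : Y ≃ₜ Y, h x = y}

/-- The set of orbits of the autohomeomorphism group of `Y`. -/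
def homeoOrbits (Y : Type*) [TopologicalSpace Y] : Set (Set Y) :=
  Set.range (homeoOrbit (Y := Y))

/-- `Y` is `1/κ`-homogeneous: the action of its autohomeomorphism group on it has exactly `κ`
orbits. -/
def IsOneOverHomogeneous (κ : Cardinal) (Y : Type*) [TopologicalSpace Y] : Prop :=
  Cardinal.mk (homeoOrbits Y) = κ

/-!
Write a point of `Σ⁽ⁿ⁾` in its normal form `(i, x)`, the point `x ≠ ⊤` of the `i`-th copy
(`CopiesCircle.coord`). The bonding maps keep `x` and reduce `i`, so a point of `S(L, p)` is a pair
`ofIndex i x` with `x ≠ ⊤` and `i` in the inverse limit `indexGroup p` of the groups `ℤ / k(n)`; it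
lies over `∞` exactly when `x = ⊥`.

*Each of the two sets lies in one orbit.* A rotation by an element of `indexGroup p`, combined with
an order automorphism of `Λ` applied in every copy, is an autohomeomorphism of `S(Λ, p)`
(`LongSolenoid.shift`). The rotations are transitive on indices, so it remains to see that the order
automorphisms of `Λ` act transitively on `(0, ω₁)`. Two given points lie in an initial segment
`[0, α)` with `α` countable, and such a segment is isomorphic to `[0, 1)`
(`nonempty_lex_Ico_orderIso_Ico`): give the ordinals `β < α` positive weights `w β` with sum `1` and
send `β + t` to `∑_{γ < β} w γ + t * w β`. On `[0, 1)` a power map moves the first point to the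
second, and the automorphism of `[0, α)` so obtained extends by the identity.

*The two orbits differ.* The isomorphism `[0, α) ≅ [0, 1)` also shows that `Λ` is first countable
below `ω₁`. Off the endpoints each copy of `Λ` is open in `Σ⁽ⁿ⁾`, so `S(Λ, p)`, a subspace of a
countable product, is first countable at the points with `x ≠ ⊥`, and singletons of such points are
`Gδ`. A point over `∞`, on the other hand, is the limit at `ω₁` of a path `x ↦ ofIndex j x`. A `Gδ`
set containing it pulls back to a `Gδ` set containing `ω₁`, hence to a neighbourhood of `ω₁`, because
`ω₁` has uncountable cofinality. So no singleton over `∞` is a `Gδ`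
(`LongSolenoid.not_isGδ_ofIndex_bot`), and autohomeomorphisms preserve this property.
-/

open Set Filter Topology

/-! ### Stacking countably many unit intervals -/

theorem tsum_indicator_Iio_add_le {ι : Type*} [LinearOrder ι] {w : ι → ℝ} (hw : ∀ i, 0 < w i)
    (hs : Summable w) {i : ι} {A : Set ι} (hA : Iic i ⊆ A) :
    ∑' k, (Iio i).indicator w k + w i ≤ ∑' k, A.indicator w k := by
  have h1 : ∑' k, ({i} : Set ι).indicator w k = w i := by
    rw [tsum_eq_single i]
    · simp
    · intro k hk
      simp [hk]
  rw [← h1, ← (hs.indicator _).tsum_add (hs.indicator _)]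
  refine ((hs.indicator _).add (hs.indicator _)).tsum_le_tsum (fun k => ?_) (hs.indicator _)
  rcases lt_trichotomy k i with h | rfl | h
  · rw [indicator_of_mem (show k ∈ Iio i from h), indicator_of_mem (hA h.le),
      indicator_of_notMem (by simpa using h.ne), add_zero]
  · rw [indicator_of_mem (hA self_mem_Iic)]
    simp
  · rw [indicator_of_notMem (by simpa using h.le), indicator_of_notMem (by simpa using h.ne'),
      add_zero]
    exact indicator_nonneg (fun _ _ => (hw _).le) _

/-- To bound the sum of `w` over `A` it is enough to bound its sums over the sets `Iic i` with `i ∈ A`,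
since every finite subset of `A` has a largest element. -/
theorem tsum_indicator_le_of_forall_mem {ι : Type*} [LinearOrder ι] {w : ι → ℝ}
    (hw : ∀ i, 0 < w i) (hs : Summable w) {r : ℝ} (hr : 0 ≤ r) {A : Set ι}
    (hA : ∀ i ∈ A, ∑' k, (Iio i).indicator w k + w i ≤ r) :
    ∑' k, A.indicator w k ≤ r := by
  classical
  refine (hs.indicator A).tsum_le_of_sum_le fun s => ?_
  rw [Finset.sum_indicator_eq_sum_filter]
  rcases (s.filter (· ∈ A)).eq_empty_or_nonempty with h | h
  · rw [h]
    simpa using hr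
  · set m := (s.filter (· ∈ A)).max' h with hm
    have hmA : m ∈ A := (Finset.mem_filter.1 (Finset.max'_mem _ h)).2
    refine le_trans ?_ (hA m hmA)
    rw [← Finset.sum_erase_add _ _ (Finset.max'_mem _ h), ← hm]
    gcongr
    refine le_trans (Finset.sum_le_sum fun k hk => ?_) ((hs.indicator (Iio m)).sum_le_tsum
      ((s.filter (· ∈ A)).erase m) fun k _ => indicator_nonneg (fun _ _ => (hw _).le) _)
    have : k ∈ Iio m := lt_of_le_of_ne (Finset.le_max' _ _ (Finset.mem_of_mem_erase hk))
      (Finset.ne_of_mem_erase hk)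
    rw [indicator_of_mem this]

/-- Countably many half-open unit intervals, stacked along a nonempty well-order, form a half-open
interval. -/
theorem nonempty_lex_Ico_orderIso_Ico (ι : Type*) [LinearOrder ι] [WellFoundedLT ι] [Countable ι]
    [Nonempty ι] : Nonempty (ι ×ₗ Ico (0 : ℝ) 1 ≃o Ico (0 : ℝ) 1) := by
  obtain ⟨w, hw, hw1⟩ : ∃ w : ι → ℝ, (∀ i, 0 < w i) ∧ HasSum w 1 := by
    have := Encodable.ofCountable ι
    obtain ⟨v, hv, c, hc, -⟩ := posSumOfEncodable one_pos ι
    have hc0 : 0 < c := by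
      rw [← hc.tsum_eq]
      exact hc.summable.tsum_pos (fun i => (hv i).le) (Classical.arbitrary ι) (hv _)
    refine ⟨fun i => v i / c, fun i => div_pos (hv i) hc0, ?_⟩
    simpa [hc0.ne'] using hc.div_const c
  have hs := hw1.summable
  set P : ι → ℝ := fun i => ∑' k, (Iio i).indicator w k with hP
  have hP0 (i) : 0 ≤ P i := tsum_nonneg fun k => indicator_nonneg (fun _ _ => (hw _).le) _
  have hP1 (i) : P i + w i ≤ 1 := by
    refine (tsum_indicator_Iio_add_le hw hs (subset_univ _)).trans_eq ?_
    rw [indicator_univ, hw1.tsum_eq]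
  have hPlt {i j} (h : i < j) : P i + w i ≤ P j :=
    tsum_indicator_Iio_add_le hw hs fun k hk => lt_of_le_of_lt hk h
  have hlt (i) (t : Ico (0 : ℝ) 1) : P i + t * w i < P i + w i := by
    have := mul_lt_mul_of_pos_right t.2.2 (hw i)
    linarith
  have hle (i) (t : Ico (0 : ℝ) 1) : P i ≤ P i + t * w i := by
    have := mul_nonneg t.2.1 (hw i).le
    linarith
  let F : ι ×ₗ Ico (0 : ℝ) 1 → Ico (0 : ℝ) 1 := fun z =>
    ⟨P (ofLex z).1 + (ofLex z).2 * w (ofLex z).1,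
      (hP0 _).trans (hle _ _), (hlt _ _).trans_le (hP1 _)⟩
  refine ⟨StrictMono.orderIsoOfSurjective F ?_ ?_⟩
  · intro a b hab
    rcases Prod.Lex.lt_iff.1 hab with h | ⟨h, h'⟩
    · exact (hlt _ _).trans_le ((hPlt h).trans (hle _ _))
    · change P (ofLex a).1 + (ofLex a).2 * w (ofLex a).1
        < P (ofLex b).1 + (ofLex b).2 * w (ofLex b).1
      rw [h]
      have := mul_lt_mul_of_pos_right (show ((ofLex a).2 : ℝ) < (ofLex b).2 from h')
        (hw (ofLex b).1)
      linarith
  · intro r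
    have hex : {i | (r : ℝ) < P i + w i}.Nonempty := by
      by_contra! hne
      have h := tsum_indicator_le_of_forall_mem hw hs r.2.1 (A := univ) fun i _ =>
        not_lt.1 fun hi => (hne ▸ (show i ∈ {i | (r : ℝ) < P i + w i} from hi) : i ∈ (∅ : Set ι))
      rw [indicator_univ, hw1.tsum_eq] at h
      exact absurd r.2.2 h.not_gt
    -- the interval that contains `r` is the first one to end beyond `r`
    obtain ⟨i, hi, hmin⟩ := wellFounded_lt.has_min _ hex
    have hi' : (r : ℝ) < P i + w i := hi
    have hir : P i ≤ r := tsum_indicator_le_of_forall_mem hw hs r.2.1 fun j hj =>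
      not_lt.1 fun h => hmin j h hj
    refine ⟨toLex (i, ⟨(r - P i) / w i, div_nonneg (by linarith) (hw i).le, ?_⟩), ?_⟩
    · rw [div_lt_one (hw i)]
      linarith
    · refine Subtype.ext ?_
      change P i + (r - P i) / w i * w i = r
      rw [div_mul_cancel₀ _ (hw i).ne']
      ring

/-! ### Order automorphisms from an initial segment -/

theorem exists_orderIso_Ico_apply_eq {u v : Ico (0 : ℝ) 1} (hu : 0 < (u : ℝ))
    (hv : 0 < (v : ℝ)) : ∃ h : Ico (0 : ℝ) 1 ≃o Ico (0 : ℝ) 1, h u = v := by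
  -- the power map `r ↦ r ^ c` takes `u` to `v` for `c = log v / log u`
  set c : ℝ := Real.log v / Real.log u with hc
  have hlu := Real.log_neg hu u.2.2
  have hlv := Real.log_neg hv v.2.2
  have hc0 : 0 < c := div_pos_of_neg_of_neg hlv hlu
  let F : Ico (0 : ℝ) 1 → Ico (0 : ℝ) 1 := fun r =>
    ⟨(r : ℝ) ^ c, Real.rpow_nonneg r.2.1 c, Real.rpow_lt_one r.2.1 r.2.2 hc0⟩
  refine ⟨StrictMono.orderIsoOfSurjective F (fun a b hab => Real.rpow_lt_rpow a.2.1 hab hc0) ?_, ?_⟩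
  · intro r
    refine ⟨⟨(r : ℝ) ^ c⁻¹, Real.rpow_nonneg r.2.1 _,
      Real.rpow_lt_one r.2.1 r.2.2 (inv_pos.2 hc0)⟩, Subtype.ext ?_⟩
    exact Real.rpow_inv_rpow r.2.1 hc0.ne'
  · refine Subtype.ext ?_
    change (u : ℝ) ^ c = v
    rw [Real.rpow_def_of_pos hu, hc, mul_div_cancel₀ _ hlu.ne, Real.exp_log hv]

/-- An order automorphism of an initial segment extends by the identity. -/
theorem OrderIso.exists_extend_Iio {α : Type*} [LinearOrder α] {a : α} (k : Iio a ≃o Iio a) :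
    ∃ f : α ≃o α, ∀ x : Iio a, f x = k x := by
  let F : α → α := fun z => if h : z < a then k ⟨z, h⟩ else z
  have hF (x : Iio a) : F x = k x := dif_pos x.2
  have hF' {x} (h : a ≤ x) : F x = x := dif_neg h.not_gt
  have hmono : StrictMono F := by
    intro x y hxy
    rcases lt_or_ge y a with hy | hy
    · have hx := hxy.trans hy
      rw [hF ⟨x, hx⟩, hF ⟨y, hy⟩]
      exact k.strictMono (show (⟨x, hx⟩ : Iio a) < ⟨y, hy⟩ from hxy)
    · rw [hF' hy]
      rcases lt_or_ge x a with hx | hx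
      · rw [hF ⟨x, hx⟩]
        exact lt_of_lt_of_le (k ⟨x, hx⟩).2 hy
      · rwa [hF' hx]
  refine ⟨StrictMono.orderIsoOfSurjective F hmono fun y => ?_, hF⟩
  rcases lt_or_ge y a with hy | hy
  · exact ⟨k.symm ⟨y, hy⟩, by rw [hF, k.apply_symm_apply]⟩
  · exact ⟨y, hF' hy⟩

theorem exists_orderIso_apply_eq_of_Iio {α : Type*} [LinearOrder α] {a x y z : α}
    (e : Iio a ≃o Ico (0 : ℝ) 1) (hzx : z < x) (hzy : z < y) (hx : x < a) (hy : y < a) :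
    ∃ f : α ≃o α, f x = y := by
  have hpos {x} (hzx : z < x) (hx : x < a) : 0 < (e ⟨x, hx⟩ : ℝ) :=
    (e ⟨z, hzx.trans hx⟩).2.1.trans_lt
      (e.strictMono (show (⟨z, hzx.trans hx⟩ : Iio a) < ⟨x, hx⟩ from hzx))
  obtain ⟨h, hh⟩ := exists_orderIso_Ico_apply_eq (hpos hzx hx) (hpos hzy hy)
  obtain ⟨f, hf⟩ := OrderIso.exists_extend_Iio ((e.trans h).trans e.symm)
  refine ⟨f, ?_⟩
  rw [hf ⟨x, hx⟩]
  simp [hh]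

/-- First countability at a point is inherited from an initial segment isomorphic to a half-open
interval. -/
theorem nhds_isCountablyGenerated_of_Iio {α : Type*} [LinearOrder α] [TopologicalSpace α]
    [OrderTopology α] {a x : α} (e : Iio a ≃o Ico (0 : ℝ) 1) (hx : x < a) :
    (𝓝 x).IsCountablyGenerated := by
  have : FirstCountableTopology (Iio a) :=
    e.toHomeomorph.isInducing.firstCountableTopology
  rw [show x = ((⟨x, hx⟩ : Iio a) : α) from rfl,
    ← isOpen_Iio.isOpenEmbedding_subtypeVal.map_nhds_eq]
  infer_instance

/-! ### The closed long line -/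

namespace ClosedLongLine

/-- The point `α + t` of the closed long line. -/
def point (α : Set.Iio (ω₁ : Ordinal.{0})) (t : Set.Ico (0 : ℝ) 1) : ClosedLongLine :=
  WithTop.some (toLex (α, t))

/-- The countable ordinal `α`, as a point of the closed long line. -/
def node (α : Set.Iio (ω₁ : Ordinal.{0})) : ClosedLongLine :=
  point α ⟨0, le_refl 0, zero_lt_one⟩

theorem point_lt_point_iff {α β : Set.Iio (ω₁ : Ordinal.{0})} {t u : Set.Ico (0 : ℝ) 1} :
    point α t < point β u ↔ α < β ∨ α = β ∧ t < u :=
  (WithTop.coe_lt_coe (α := Set.Iio (ω₁ : Ordinal.{0}) ×ₗ Set.Ico (0 : ℝ) 1)).trans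
    Prod.Lex.toLex_lt_toLex

theorem point_lt_node_iff {α β : Set.Iio (ω₁ : Ordinal.{0})} {t : Set.Ico (0 : ℝ) 1} :
    point β t < node α ↔ β < α :=
  point_lt_point_iff.trans (or_iff_left fun h => h.2.not_ge t.2.1)

theorem node_lt_top (α : Set.Iio (ω₁ : Ordinal.{0})) : node α < ⊤ :=
  WithTop.coe_lt_top (α := Set.Iio (ω₁ : Ordinal.{0}) ×ₗ Set.Ico (0 : ℝ) 1) _

theorem exists_eq_point {x : ClosedLongLine} (hx : x ≠ ⊤) : ∃ β t, x = point β t := by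
  obtain ⟨z, hz⟩ := WithTop.ne_top_iff_exists.1 hx
  exact ⟨(ofLex z).1, (ofLex z).2, hz.symm⟩

theorem exists_forall_lt_node {ι : Type*} [Countable ι] {x : ι → ClosedLongLine}
    (hx : ∀ i, x i ≠ ⊤) : ∃ α, ∀ i, x i < node α := by
  choose β t h using fun i => exists_eq_point (hx i)
  have hsup : ⨆ i, (β i : Ordinal) < ω₁ := Ordinal.iSup_lt_omega_one fun i => (β i).2
  have hbdd : BddAbove (range fun i => (β i : Ordinal)) :=
    ⟨ω₁, by rintro _ ⟨i, rfl⟩; exact (β i).2.le⟩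
  refine ⟨⟨Order.succ (⨆ i, (β i : Ordinal)),
    (Cardinal.isSuccLimit_omega 1).succ_lt hsup⟩, fun i => ?_⟩
  rw [h i, point_lt_node_iff]
  exact Order.lt_succ_of_le (le_ciSup hbdd i)

instance : Nontrivial ClosedLongLine :=
  ⟨node ⟨0, Ordinal.omega_pos 1⟩, ⊤, (node_lt_top _).ne⟩

/-- A countable intersection of neighbourhoods of `ω₁` is a neighbourhood of `ω₁`, since `ω₁` has
uncountable cofinality. -/
instance : CountableInterFilter (𝓝 (⊤ : ClosedLongLine)) where
  countable_sInter_mem S hS hmem := by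
    have := hS.to_subtype
    choose l hl hlS using fun s : S =>
      exists_Ioc_subset_of_mem_nhds (hmem s s.2) ⟨_, node_lt_top ⟨0, Ordinal.omega_pos 1⟩⟩
    obtain ⟨α, hα⟩ := exists_forall_lt_node fun s => (hl s).ne
    refine mem_of_superset (Ioi_mem_nhds (node_lt_top α)) fun y hy s hs => ?_
    exact hlS ⟨s, hs⟩ ⟨(hα ⟨s, hs⟩).trans hy, le_top⟩

theorem nonempty_Iio_node_orderIso (α : Set.Iio (ω₁ : Ordinal.{0})) (hα : ∃ β, β < α) :
    Nonempty (Iio (node α) ≃o Ico (0 : ℝ) 1) := by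
  obtain ⟨β, hβ⟩ := hα
  have : Nonempty (Iio α) := ⟨⟨β, hβ⟩⟩
  have hα' : Countable (Iio (α : Ordinal.{0})) := by
    rw [← Cardinal.mk_le_aleph0_iff, Cardinal.mk_Iio_ordinal, Cardinal.lift_le_aleph0,
      ← Order.lt_succ_iff, Cardinal.succ_aleph0, ← Cardinal.lt_ord, Cardinal.ord_aleph]
    exact α.2
  have : Countable (Iio α) :=
    Function.Injective.countable (f := fun γ : Iio α => (⟨γ.1.1, γ.2⟩ : Iio (α : Ordinal.{0})))
      fun a b h => Subtype.ext (Subtype.ext (Subtype.mk.inj h))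
  obtain ⟨e⟩ := nonempty_lex_Ico_orderIso_Ico (Iio α)
  let F : Iio α ×ₗ Ico (0 : ℝ) 1 → Iio (node α) := fun z =>
    ⟨point (ofLex z).1.1 (ofLex z).2, point_lt_node_iff.2 (ofLex z).1.2⟩
  have hF : StrictMono F := by
    intro a b hab
    refine point_lt_point_iff.2 ?_
    rcases Prod.Lex.lt_iff.1 hab with h | ⟨h, h'⟩
    · exact Or.inl h
    · exact Or.inr ⟨congrArg Subtype.val h, h'⟩
  refine ⟨(StrictMono.orderIsoOfSurjective F hF fun y => ?_).symm.trans e⟩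
  obtain ⟨γ, t, h⟩ := exists_eq_point (y.2.trans (node_lt_top α)).ne
  have hγ : γ < α := point_lt_node_iff.1 (h ▸ y.2)
  exact ⟨toLex (⟨γ, hγ⟩, t), Subtype.ext h.symm⟩

/-- Any two points below `ω₁` lie in a common initial segment isomorphic to `[0, 1)`. -/
theorem exists_Iio_orderIso {x y : ClosedLongLine} (hx : x ≠ ⊤) (hy : y ≠ ⊤) :
    ∃ a, x < a ∧ y < a ∧ Nonempty (Iio a ≃o Ico (0 : ℝ) 1) := by
  obtain ⟨α, hα⟩ := exists_forall_lt_node (x := ![x, y])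
    (by intro i; fin_cases i <;> assumption)
  obtain ⟨β, t, h⟩ := exists_eq_point hx
  refine ⟨node α, hα 0, hα 1, nonempty_Iio_node_orderIso α ⟨β, ?_⟩⟩
  have hlt : x < node α := hα 0
  rw [h] at hlt
  exact point_lt_node_iff.1 hlt

theorem exists_between_top {x : ClosedLongLine} (hx : x < ⊤) : ∃ y, x < y ∧ y < ⊤ := by
  obtain ⟨a, hxa⟩ := exists_forall_lt_node fun _ : Unit => hx.ne
  exact ⟨node a, hxa (), node_lt_top a⟩

theorem exists_orderIso_apply_eq {x y : ClosedLongLine} (hx : x ≠ ⊥) (hx' : x ≠ ⊤) (hy : y ≠ ⊥)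
    (hy' : y ≠ ⊤) : ∃ f : ClosedLongLine ≃o ClosedLongLine, f x = y := by
  obtain ⟨a, hxa, hya, ⟨e⟩⟩ := exists_Iio_orderIso hx' hy'
  exact exists_orderIso_apply_eq_of_Iio e (bot_lt_iff_ne_bot.2 hx) (bot_lt_iff_ne_bot.2 hy) hxa hya

theorem nhds_isCountablyGenerated {x : ClosedLongLine} (hx : x ≠ ⊤) :
    (𝓝 x).IsCountablyGenerated := by
  obtain ⟨a, hxa, -, ⟨e⟩⟩ := exists_Iio_orderIso hx hx
  exact nhds_isCountablyGenerated_of_Iio e hxa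

end ClosedLongLine

/-! ### The circles `Σ⁽ⁿ⁾` -/

theorem bot_lt_top_of_nontrivial (L : Type*) [PartialOrder L] [OrderBot L] [OrderTop L]
    [Nontrivial L] : (⊥ : L) < ⊤ :=
  let _ : BoundedOrder L := BoundedOrder.mk
  bot_lt_top

namespace CopiesCircle

section

variable {L : Type*} [LinearOrder L] [OrderBot L] [OrderTop L]

theorem mk_top {n : ℕ} (i : ZMod n) : mk i (⊤ : L) = mk (i + 1) ⊥ :=
  Quot.sound ⟨i, rfl, rfl⟩

theorem bondingMap_mk {m n : ℕ} (i : ZMod (m * n)) (x : L) :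
    bondingMap L m n (mk i x) = mk (ZMod.castHom (Dvd.intro_left m rfl) (ZMod n) i) x :=
  rfl

/-- The self-map of `Σ⁽ⁿ⁾` that sends the point `x` of the `i`-th copy to the point `f x` of the
`(i + g)`-th copy. -/
def shiftMap {n : ℕ} (g : ZMod n) (f : L ≃o L) : CopiesCircle L n → CopiesCircle L n :=
  Quot.lift (fun a => mk (a.1 + g) (f a.2)) <| by
    rintro _ _ ⟨i, rfl, rfl⟩
    rw [f.map_top, f.map_bot, mk_top]
    rw [add_right_comm]

theorem shiftMap_mk {n : ℕ} (g : ZMod n) (f : L ≃o L) (i : ZMod n) (x : L) :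
    shiftMap g f (mk i x) = mk (i + g) (f x) :=
  rfl

theorem shiftMap_neg_symm {n : ℕ} (g : ZMod n) (f : L ≃o L) (q : CopiesCircle L n) :
    shiftMap (-g) f.symm (shiftMap g f q) = q := by
  induction q using Quot.ind with
  | mk a =>
    change shiftMap (-g) f.symm (shiftMap g f (mk a.1 a.2)) = mk a.1 a.2
    simp [shiftMap_mk]

theorem bondingMap_shiftMap {m n : ℕ} (g : ZMod (m * n)) (f : L ≃o L)
    (q : CopiesCircle L (m * n)) :
    bondingMap L m n (shiftMap g f q) =
      shiftMap (ZMod.castHom (Dvd.intro_left m rfl) (ZMod n) g) f (bondingMap L m n q) := by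
  induction q using Quot.ind with
  | mk a =>
    change bondingMap L m n (shiftMap g f (mk a.1 a.2)) =
      shiftMap _ f (bondingMap L m n (mk a.1 a.2))
    simp only [shiftMap_mk, bondingMap_mk, map_add]

variable [Nontrivial L]

/-- The normal form of a point of `Σ⁽ⁿ⁾`: the unique pair `(i, x)` with `x ≠ ⊤` such that the point
is the point `x` of the `i`-th copy. -/
def coord {n : ℕ} : CopiesCircle L n → ZMod n × L :=
  Quot.lift (fun a => if a.2 = ⊤ then (a.1 + 1, ⊥) else a) <| by
    rintro _ _ ⟨i, rfl, rfl⟩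
    simp [(bot_lt_top_of_nontrivial L).ne]

theorem coord_mk_top {n : ℕ} (i : ZMod n) : coord (mk i (⊤ : L)) = (i + 1, ⊥) :=
  if_pos rfl

theorem coord_mk {n : ℕ} (i : ZMod n) {x : L} (hx : x ≠ ⊤) : coord (mk i x) = (i, x) :=
  if_neg hx

theorem mk_coord {n : ℕ} (q : CopiesCircle L n) : mk (coord q).1 (coord q).2 = q := by
  induction q using Quot.ind with
  | mk a =>
    obtain ⟨i, x⟩ := a
    change mk (coord (mk i x)).1 (coord (mk i x)).2 = mk i x
    by_cases hx : x = ⊤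
    · subst hx
      rw [coord_mk_top, mk_top]
    · rw [coord_mk i hx]

theorem coord_snd_ne_top {n : ℕ} (q : CopiesCircle L n) : (coord q).2 ≠ ⊤ := by
  induction q using Quot.ind with
  | mk a =>
    obtain ⟨i, x⟩ := a
    change (coord (mk i x)).2 ≠ ⊤
    by_cases hx : x = ⊤
    · subst hx
      rw [coord_mk_top]
      exact (bot_lt_top_of_nontrivial L).ne
    · rwa [coord_mk i hx]

theorem coord_bondingMap {m n : ℕ} (q : CopiesCircle L (m * n)) :
    coord (bondingMap L m n q) =
      (ZMod.castHom (Dvd.intro_left m rfl) (ZMod n) (coord q).1, (coord q).2) := by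
  conv_lhs => rw [← mk_coord q, bondingMap_mk, coord_mk _ (coord_snd_ne_top q)]

theorem eq_infty_iff {q : CopiesCircle L 1} : q = infty L 0 ↔ (coord q).2 = ⊥ := by
  constructor
  · rintro rfl
    rw [infty, coord_mk _ (bot_lt_top_of_nontrivial L).ne]
  · intro h
    rw [← mk_coord q, h, infty, Subsingleton.elim (coord q).1 0]

end

section Topology

variable {L : Type*} [LinearOrder L] [OrderBot L] [OrderTop L] [TopologicalSpace L]

theorem continuous_quotMk {n : ℕ} :
    Continuous (fun a : ZMod n × L => (mk a.1 a.2 : CopiesCircle L n)) :=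
  continuous_quot_mk

theorem continuous_mk {n : ℕ} (i : ZMod n) : Continuous (mk i : L → CopiesCircle L n) :=
  continuous_quotMk.comp (Continuous.prodMk_right i)

theorem isQuotientMap_mk {n : ℕ} :
    IsQuotientMap (fun a : ZMod n × L => (mk a.1 a.2 : CopiesCircle L n)) :=
  isQuotientMap_quot_mk

instance [Nontrivial L] [T1Space L] {n : ℕ} : T1Space (CopiesCircle L n) where
  t1 q := by
    refine isQuotientMap_mk.isClosed_preimage.1 (Set.Finite.isClosed ?_)
    refine Set.Finite.subset (Set.toFinite {coord q, ((coord q).1 - 1, ⊤)}) ?_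
    rintro ⟨i, x⟩ rfl
    by_cases hx : x = ⊤
    · subst hx
      right
      simp [coord_mk_top]
    · left
      rw [coord_mk i hx]

/-- Away from the endpoints, the copies of `L` are open in `Σ⁽ⁿ⁾`. -/
theorem nhds_mk [Nontrivial L] [OrderTopology L] {n : ℕ} (i : ZMod n) {x : L} (hx : x ≠ ⊥)
    (hx' : x ≠ ⊤) : 𝓝 (mk i x : CopiesCircle L n) = map (mk i) (𝓝 x) := by
  refine le_antisymm (fun U hU => ?_) (continuous_mk i).continuousAt
  have hI : Ioo (⊥ : L) ⊤ ∈ 𝓝 x := Ioo_mem_nhds (bot_lt_iff_ne_bot.2 hx) (lt_top_iff_ne_top.2 hx')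
  obtain ⟨V, hVU, hV, hxV⟩ := mem_nhds_iff.1 (inter_mem hU hI)
  refine mem_nhds_iff.2 ⟨mk i '' V, image_subset_iff.2 fun y hy => (hVU hy).1, ?_,
    mem_image_of_mem _ hxV⟩
  have hpre : (fun a : ZMod n × L => (mk a.1 a.2 : CopiesCircle L n)) ⁻¹' (mk i '' V) =
      {i} ×ˢ V := by
    ext ⟨j, y⟩
    constructor
    · rintro ⟨z, hz, h⟩
      have h1 := congrArg coord h
      have hz' := (hVU hz).2
      rw [coord_mk i hz'.2.ne] at h1
      by_cases hy : y = ⊤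
      · subst hy
        rw [coord_mk_top] at h1
        exact absurd (congrArg Prod.snd h1) hz'.1.ne'
      · rw [coord_mk j hy] at h1
        obtain ⟨rfl, rfl⟩ := Prod.mk.inj h1
        exact ⟨rfl, hz⟩
    · rintro ⟨rfl, hy⟩
      exact mem_image_of_mem _ hy
  rw [← isQuotientMap_mk.isOpen_preimage, hpre]
  exact (isOpen_discrete _).prod hV

theorem continuous_shiftMap [OrderTopology L] {n : ℕ} (g : ZMod n) (f : L ≃o L) :
    Continuous (shiftMap g f : CopiesCircle L n → CopiesCircle L n) :=
  continuous_quot_lift _ <| continuous_quotMk.comp <|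
    (continuous_of_discreteTopology (f := fun i : ZMod n => i + g)).prodMap f.continuous

end Topology

end CopiesCircle

/-! ### The inverse limit -/

/-- The reduction `ℤ / k(n + 1) → ℤ / k(n)` by which the bonding maps act on the indices of the
copies. -/
def indexMap (p : ℕ → ℕ) (n : ℕ) : ZMod (numCopies p (n + 1)) →+* ZMod (numCopies p n) :=
  ZMod.castHom (Dvd.intro_left (p n) rfl) (ZMod (numCopies p n))

/-- The inverse limit of the groups `ℤ / k(n)`, as a subgroup of their product. It acts on
`LongSolenoid L p` by rotations. -/
def indexGroup (p : ℕ → ℕ) : AddSubgroup ((n : ℕ) → ZMod (numCopies p n)) where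
  carrier := {g | ∀ n, indexMap p n (g (n + 1)) = g n}
  add_mem' {a b} ha hb n := by
    rw [Pi.add_apply, Pi.add_apply, map_add, ha n, hb n]
  zero_mem' n := map_zero _
  neg_mem' {a} ha n := by
    rw [Pi.neg_apply, Pi.neg_apply, map_neg, ha n]

theorem one_mem_indexGroup (p : ℕ → ℕ) : 1 ∈ indexGroup p := fun _ => map_one _

namespace LongSolenoid

open CopiesCircle

variable {L : Type*} [LinearOrder L] [OrderBot L] [OrderTop L]
  {p : ℕ → ℕ}

/-- The point of `S(L, p)` at height `x` in the copies of `L` with indices `i 0, i 1, …`. -/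
def ofIndex (i : indexGroup p) (x : L) : LongSolenoid L p :=
  ⟨fun n => mk (i.1 n) x, fun n => congrArg (mk · x) (i.2 n)⟩

theorem isInducing_val [TopologicalSpace L] :
    IsInducing (Subtype.val : LongSolenoid L p → (n : ℕ) → CopiesCircle L (numCopies p n)) :=
  IsInducing.subtypeVal

theorem continuous_ofIndex [TopologicalSpace L] (i : indexGroup p) :
    Continuous (ofIndex i : L → LongSolenoid L p) :=
  isInducing_val.continuous_iff.2 (continuous_pi fun _ => continuous_mk _)

theorem ofIndex_top (i : indexGroup p) :
    ofIndex i (⊤ : L) = ofIndex (i + ⟨1, one_mem_indexGroup p⟩) ⊥ :=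
  Subtype.ext (funext fun _ => mk_top _)

/-- A rotation `g` combined with an order automorphism `f` of `L`, as a self-map of `S(L, p)`. -/
def shiftFun (g : indexGroup p) (f : L ≃o L) (s : LongSolenoid L p) : LongSolenoid L p :=
  ⟨fun n => shiftMap (g.1 n) f (s.1 n), fun n =>
    (bondingMap_shiftMap _ _ _).trans (congrArg₂ (shiftMap · f) (g.2 n) (s.2 n))⟩

theorem shiftFun_ofIndex (g i : indexGroup p) (f : L ≃o L) (x : L) :
    shiftFun g f (ofIndex i x) = ofIndex (i + g) (f x) :=
  rfl

theorem shiftFun_neg_symm (g : indexGroup p) (f : L ≃o L) (s : LongSolenoid L p) :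
    shiftFun (-g) f.symm (shiftFun g f s) = s :=
  Subtype.ext (funext fun _ => shiftMap_neg_symm _ _ _)

theorem continuous_shiftFun [TopologicalSpace L] [OrderTopology L] (g : indexGroup p)
    (f : L ≃o L) : Continuous (shiftFun g f : LongSolenoid L p → LongSolenoid L p) :=
  isInducing_val.continuous_iff.2 (continuous_pi fun n =>
    (continuous_shiftMap (g.1 n) f).comp ((continuous_apply n).comp isInducing_val.continuous))

/-- `shiftFun`, as an autohomeomorphism of `S(L, p)`. -/
def shift [TopologicalSpace L] [OrderTopology L] (g : indexGroup p) (f : L ≃o L) :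
    LongSolenoid L p ≃ₜ LongSolenoid L p where
  toFun := shiftFun g f
  invFun := shiftFun (-g) f.symm
  left_inv := shiftFun_neg_symm g f
  right_inv s := by
    have := shiftFun_neg_symm (-g) f.symm s
    rwa [neg_neg, OrderIso.symm_symm] at this
  continuous_toFun := continuous_shiftFun g f
  continuous_invFun := continuous_shiftFun (-g) f.symm

instance [TopologicalSpace L] [Nontrivial L] [T1Space L] : T1Space (LongSolenoid L p) :=
  inferInstanceAs (T1Space {s : (n : ℕ) → CopiesCircle L (numCopies p n) //
    ∀ n, bondingMap L (p n) (numCopies p n) (s (n + 1)) = s n})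

theorem first_ofIndex_eq_infty_iff [Nontrivial L] {i : indexGroup p} {x : L} (hx : x ≠ ⊤) :
    (ofIndex i x).first = infty L 0 ↔ x = ⊥ := by
  have h : coord (ofIndex i x).first = (i.1 0, x) := coord_mk _ hx
  rw [eq_infty_iff, h]

theorem exists_eq_ofIndex [Nontrivial L] (s : LongSolenoid L p) :
    ∃ (i : indexGroup p) (x : L), x ≠ ⊤ ∧ s = ofIndex i x := by
  have hstep (n : ℕ) := (coord_bondingMap (m := p n) (n := numCopies p n) (s.1 (n + 1))).symm.trans
    (congrArg coord (s.2 n))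
  have hconst (n : ℕ) : (coord (s.1 n)).2 = (coord (s.1 0)).2 := by
    induction n with
    | zero => rfl
    | succ n ih => exact (congrArg Prod.snd (hstep n)).trans ih
  refine ⟨⟨fun n => (coord (s.1 n)).1, fun n => congrArg Prod.fst (hstep n)⟩, (coord (s.1 0)).2,
    coord_snd_ne_top _, Subtype.ext (funext fun n => ?_)⟩
  change s.1 n = mk (coord (s.1 n)).1 (coord (s.1 0)).2
  rw [← hconst n, mk_coord]

theorem nhds_isCountablyGenerated [TopologicalSpace L] [Nontrivial L] [OrderTopology L] (i : indexGroup p) {x : L}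
    (hx : x ≠ ⊥) (hx' : x ≠ ⊤) [(𝓝 x).IsCountablyGenerated] :
    (𝓝 (ofIndex i x : LongSolenoid L p)).IsCountablyGenerated := by
  have (n : ℕ) : (𝓝 ((ofIndex i x : LongSolenoid L p).1 n)).IsCountablyGenerated := by
    rw [show (ofIndex i x : LongSolenoid L p).1 n = mk (i.1 n) x from rfl, nhds_mk _ hx hx']
    infer_instance
  have : (𝓝 (ofIndex i x : LongSolenoid L p).1).IsCountablyGenerated := by
    rw [nhds_pi]
    infer_instance
  exact (isInducing_val.nhds_eq_comap (ofIndex i x : LongSolenoid L p)).symm ▸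
    comap.isCountablyGenerated _ _

/-- The path `x ↦ ofIndex i x` reaches a point of the fibre over `∞` as `x` tends to `⊤`; pulled
back along it, a `Gδ` singleton would be a neighbourhood of `⊤`. -/
theorem not_isGδ_ofIndex_bot [TopologicalSpace L] [Nontrivial L] [OrderTopology L] 
    [CountableInterFilter (𝓝 (⊤ : L))] (hL : ∀ l < (⊤ : L), ∃ y, l < y ∧ y < ⊤) (i : indexGroup p) :
    ¬ IsGδ {(ofIndex i ⊥ : LongSolenoid L p)} := by
  intro h
  obtain ⟨j, rfl⟩ : ∃ j, i = j + ⟨1, one_mem_indexGroup p⟩ := ⟨i - _, (sub_add_cancel _ _).symm⟩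
  rw [← ofIndex_top] at h
  obtain ⟨T, hTo, hTc, hT⟩ := h
  have hmem : ofIndex j ⁻¹' {(ofIndex j ⊤ : LongSolenoid L p)} ∈ 𝓝 (⊤ : L) := by
    rw [hT, preimage_sInter]
    refine (countable_bInter_mem hTc).2 fun U hU => ?_
    refine (hTo U hU).preimage (continuous_ofIndex j) |>.mem_nhds ?_
    exact mem_sInter.1 (hT ▸ mem_singleton _) U hU
  obtain ⟨l, hl, hlT⟩ := exists_Ioc_subset_of_mem_nhds hmem ⟨⊥, bot_lt_top_of_nontrivial L⟩
  obtain ⟨y, hly, hy⟩ := hL l hl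
  have hfst := congrArg first (show ofIndex j y = ofIndex j ⊤ from hlT ⟨hly, hy.le⟩)
  rw [ofIndex_top, (first_ofIndex_eq_infty_iff (bot_lt_top_of_nontrivial L).ne).2 rfl,
    first_ofIndex_eq_infty_iff hy.ne] at hfst
  exact not_lt_bot (hfst ▸ hly)

end LongSolenoid

/-! ### Orbits -/

theorem isGδ_singleton_of_isCountablyGenerated {Y : Type*} [TopologicalSpace Y] [T1Space Y]
    (x : Y) [(𝓝 x).IsCountablyGenerated] : IsGδ {x} := by
  obtain ⟨U, hU, hb⟩ := (nhds_basis_opens x).exists_antitone_subbasis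
  rw [← biInter_basis_nhds hb.toHasBasis]
  exact .biInter (to_countable _) fun n _ => (hU n).2.isGδ

theorem Homeomorph.isGδ_singleton_apply_iff {X Y : Type*} [TopologicalSpace X]
    [TopologicalSpace Y] (h : X ≃ₜ Y) (x : X) : IsGδ {h x} ↔ IsGδ {x} := by
  constructor
  · intro hx
    have := hx.preimage h.continuous
    rwa [← image_singleton, h.injective.preimage_image] at this
  · intro hx
    have := hx.preimage h.symm.continuous
    rwa [← h.image_eq_preimage_symm, image_singleton] at this

namespace LongSolenoid

open CopiesCircle

variable {p : ℕ → ℕ}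

theorem nhds_isCountablyGenerated_of_first_ne {s : LongSolenoid ClosedLongLine p}
    (hs : s.first ≠ infty ClosedLongLine 0) : (𝓝 s).IsCountablyGenerated := by
  obtain ⟨i, x, hx, rfl⟩ := exists_eq_ofIndex s
  rw [Ne, first_ofIndex_eq_infty_iff hx] at hs
  have := ClosedLongLine.nhds_isCountablyGenerated hx
  exact nhds_isCountablyGenerated i hs hx

theorem isGδ_singleton_iff {s : LongSolenoid ClosedLongLine p} :
    IsGδ {s} ↔ s.first ≠ infty ClosedLongLine 0 := by
  refine ⟨fun h hs => ?_, fun hs => ?_⟩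
  · obtain ⟨i, x, hx, rfl⟩ := exists_eq_ofIndex s
    obtain rfl := (first_ofIndex_eq_infty_iff hx).1 hs
    exact not_isGδ_ofIndex_bot (fun _ => ClosedLongLine.exists_between_top) i h
  · have := nhds_isCountablyGenerated_of_first_ne hs
    exact isGδ_singleton_of_isCountablyGenerated s

theorem mem_homeoOrbit_iff {s t : LongSolenoid ClosedLongLine p} :
    t ∈ homeoOrbit s ↔ (t.first = infty ClosedLongLine 0 ↔ s.first = infty ClosedLongLine 0) := by
  constructor
  · rintro ⟨h, rfl⟩
    rw [← not_iff_not, ← Ne, ← Ne, ← isGδ_singleton_iff, ← isGδ_singleton_iff,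
      h.isGδ_singleton_apply_iff]
  · intro h
    obtain ⟨i, x, hx, rfl⟩ := exists_eq_ofIndex s
    obtain ⟨j, y, hy, rfl⟩ := exists_eq_ofIndex t
    rw [first_ofIndex_eq_infty_iff hx, first_ofIndex_eq_infty_iff hy] at h
    obtain ⟨f, hf⟩ : ∃ f : ClosedLongLine ≃o ClosedLongLine, f x = y := by
      by_cases hxb : x = ⊥
      · exact ⟨OrderIso.refl _, hxb.trans (h.2 hxb).symm⟩
      · exact ClosedLongLine.exists_orderIso_apply_eq hxb hx (mt h.1 hxb) hy
    refine ⟨shift (j - i) f, (shiftFun_ofIndex _ _ _ _).trans ?_⟩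
    rw [add_sub_cancel, hf]

theorem homeoOrbit_eq_of_first_ne {s : LongSolenoid ClosedLongLine p}
    (hs : s.first ≠ infty ClosedLongLine 0) :
    homeoOrbit s = {s | s.first ≠ infty ClosedLongLine 0} :=
  ext fun _ => mem_homeoOrbit_iff.trans (iff_false_right hs)

theorem homeoOrbit_eq_of_first_eq {s : LongSolenoid ClosedLongLine p}
    (hs : s.first = infty ClosedLongLine 0) :
    homeoOrbit s = {s | s.first = infty ClosedLongLine 0} :=
  ext fun _ => mem_homeoOrbit_iff.trans (iff_true_right hs)

theorem exists_first_ne (p : ℕ → ℕ) :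
    ∃ s : LongSolenoid ClosedLongLine p, s.first ≠ infty ClosedLongLine 0 := by
  obtain ⟨x, hx, hx'⟩ := ClosedLongLine.exists_between_top (bot_lt_top_of_nontrivial _)
  exact ⟨ofIndex 0 x, (first_ofIndex_eq_infty_iff hx'.ne).not.2 hx.ne'⟩

theorem exists_first_eq (p : ℕ → ℕ) :
    ∃ s : LongSolenoid ClosedLongLine p, s.first = infty ClosedLongLine 0 :=
  ⟨ofIndex 0 ⊥, (first_ofIndex_eq_infty_iff (bot_lt_top_of_nontrivial _).ne).2 rfl⟩

theorem homeoOrbits_eq (p : ℕ → ℕ) :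
    homeoOrbits (LongSolenoid ClosedLongLine p) =
      {{s | s.first ≠ infty ClosedLongLine 0}, {s | s.first = infty ClosedLongLine 0}} := by
  refine Subset.antisymm ?_ ?_
  · rintro _ ⟨s, rfl⟩
    by_cases hs : s.first = infty ClosedLongLine 0
    · exact Or.inr (homeoOrbit_eq_of_first_eq hs)
    · exact Or.inl (homeoOrbit_eq_of_first_ne hs)
  · rintro _ (rfl | rfl)
    · obtain ⟨s, hs⟩ := exists_first_ne p
      exact ⟨s, homeoOrbit_eq_of_first_ne hs⟩
    · obtain ⟨s, hs⟩ := exists_first_eq p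
      exact ⟨s, homeoOrbit_eq_of_first_eq hs⟩

end LongSolenoid

theorem mainTheorem2 (p : ℕ → ℕ) (hp : ∀ n, 0 < p n) :
    IsOneOverHomogeneous 2 (LongSolenoid ClosedLongLine p) ∧
    homeoOrbits (LongSolenoid ClosedLongLine p) =
      {{s | s.first ≠ CopiesCircle.infty ClosedLongLine 0},
       {s | s.first = CopiesCircle.infty ClosedLongLine 0}} ∧
    (∀ s : LongSolenoid ClosedLongLine p,
      s.first ≠ CopiesCircle.infty ClosedLongLine 0 → (𝓝 s).IsCountablyGenerated) ∧
    (∀ s : LongSolenoid ClosedLongLine p,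
      s.first = CopiesCircle.infty ClosedLongLine 0 → ¬ IsGδ {s}) := by
  refine ⟨?_, LongSolenoid.homeoOrbits_eq p,
    fun s => LongSolenoid.nhds_isCountablyGenerated_of_first_ne,
    fun s hs h => LongSolenoid.isGδ_singleton_iff.1 h hs⟩
  obtain ⟨s, hs⟩ := LongSolenoid.exists_first_eq p
  have hne : {s : LongSolenoid ClosedLongLine p | s.first ≠ CopiesCircle.infty ClosedLongLine 0} ∉
      ({{s | s.first = CopiesCircle.infty ClosedLongLine 0}} :
        Set (Set (LongSolenoid ClosedLongLine p))) := fun h =>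
    (show s ∈ {s : LongSolenoid ClosedLongLine p |
      s.first ≠ CopiesCircle.infty ClosedLongLine 0} from (mem_singleton_iff.1 h).symm ▸ hs) hs
  rw [IsOneOverHomogeneous, LongSolenoid.homeoOrbits_eq, Cardinal.mk_insert hne,
    Cardinal.mk_singleton, one_add_one_eq_two]
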